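/- An *o-machine* with oracle $X\subseteq\mathbb N=\{0,1,2,\dots\}$ is a deterministic single-tape Turing machine with a finite instruction table, a query state and two answer states: if, in the query state, the special symbol $\mu$ is inscribed on exactly two squares of the tape and there are $k$ squares between them, the machine goes to the yes-state if $k\in X$ and to the no-state if $k\notin X$, leaving the tape unchanged. (If the tape contains $\mu$ on any other number of squares, or if no instruction applies, the machine halts.) The o-machines are indexed by the natural numbers through a fixed standard Gödel numbering of instruction tables. A *probabilistic Turing machine* (PTM) is a deterministic single-tape Turing machine, with finitely many states and symbols, that has a randomising state; a PTM *equipped with* a probability $p\in[0,1]$ tosses, whenever it is in this state, a coin that comes up heads with probability $p$, independently of all earlier tosses, and goes to its specified 1-state on heads and to its specified 0-state on tails. Inputs and outputs are natural numbers, written on the tape in unary. For $X\subseteq\mathbb N$ let $$p_X=\sum_{n\in X}2^{-(n+1)},$$ the real number in $[0,1]$ with binary expansion $0.d_0d_1d_2\dots$, where $d_n=1$ if $n\in X$ and $d_n=0$ otherwise. **Theorem.** There is a single PTM $P_U$ with the following property. Let $X\subseteq\mathbb N$ be such that $p_X$ is not a dyadic rational (that is, not of the form $a/2^k$ with $a\in\mathbb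 Z$, $k\in\mathbb N$). Then, for all $j,n,m\in\mathbb N$, the PTM $P_U$ equipped with $p_X$ and run on the inputs $j,n,m$ computes the result of applying the o-machine with oracle $X$ and index $n$ to the input $m$ with probability at least $1-2^{-j}$: if the o-machine halts on $m$ with output $r$, then $P_U$ halts with output $r$ with probability at least $1-2^{-j}$; if the o-machine does not halt on $m$, then $P_U$ does not halt with probability at least $1-2^{-j}$. -/

import Mathlib

open MeasureTheory ProbabilityTheory

/-! Machines are single-tape Turing machines (`Turing.TM0`, one instruction per pair of state and
scanned symbol: print a symbol or move one square, and go to a state; a machine halts when no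
instruction applies), extended by one special state whose successor is one of two answer states. -/

/-- The number written in unary at the scanned square: how many consecutive squares, from the
scanned one to the right, carry the symbol `one` (a tape has finitely many non-blank squares, so
this is finite when `one` is not the blank symbol `default`). -/
noncomputable def unaryRead {Γ : Type} [Inhabited Γ] (one : Γ) (T : Turing.Tape Γ) : ℕ :=
  sInf {k : ℕ | T.nth (k : ℤ) ≠ one}

/-! ### Oracle machines -/

/-- An o-machine is given by its finite table of instructions `((q, a), (q', i))`: in state `q`,
scanning the symbol `a`, perform the action coded by `i` and go to the state `q'`. If the table has
several entries for the same `(q, a)`, the first one counts. States and symbols are natural numbers;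
the initial state is `0` and the blank symbol is `0`. -/
abbrev OMachine : Type := List ((ℕ × ℕ) × (ℕ × ℕ))

namespace OMachine

/-- The o-machine with index `n`, in the standard bijective Gödel numbering of finite tables. -/
def ofIndex (n : ℕ) : OMachine := Denumerable.ofNat OMachine n

/-- Every o-machine has an index. -/
theorem exists_index (M : OMachine) : ∃ n, ofIndex n = M :=
  ⟨Encodable.encode M, Denumerable.ofNat_encode M⟩

/-- The query state. -/
def queryState : ℕ := 1

/-- The state entered from the query state if the answer is yes. -/
def yesState : ℕ := 2

/-- The state entered from the query state if the answer is no. -/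
def noState : ℕ := 3

/-- The symbol in which inputs and outputs are written in unary. -/
def stroke : ℕ := 1

/-- The special symbol that delimits a query to the oracle. -/
def mu : ℕ := 2

/-- Action `0` moves left, action `1` moves right, action `a + 2` prints the symbol `a`. -/
def action : ℕ → Turing.TM0.Stmt ℕ
  | 0 => .move .left
  | 1 => .move .right
  | a + 2 => .write a

/-- The Turing machine (symbols `ℕ`, states `ℕ`) described by the table. -/
def machine (M : OMachine) : Turing.TM0.Machine ℕ ℕ :=
  fun q a => (M.lookup (q, a)).map fun e => (e.1, action e.2)

/-- The tape poses the query `n`: the symbol `mu` is inscribed on exactly two squares, and there are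
`n` squares between them. -/
def Queries (T : Turing.Tape ℕ) (n : ℕ) : Prop :=
  ∃ i : ℤ, ∀ k : ℤ, T.nth k = mu ↔ k = i ∨ k = i + n + 1

open Classical in
/-- The state that follows the query state, for the oracle set `X`. There is none if the tape poses
no query. -/
noncomputable def answer (X : Set ℕ) (T : Turing.Tape ℕ) : Option ℕ :=
  if ∃ n, Queries T n ∧ n ∈ X then some yesState
  else if ∃ n, Queries T n ∧ n ∉ X then some noState
  else none

/-- One step of the o-machine `M` with oracle `X`. -/
noncomputable def step (M : OMachine) (X : Set ℕ) (c : Turing.TM0.Cfg ℕ ℕ) :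
    Option (Turing.TM0.Cfg ℕ ℕ) :=
  if c.q = queryState then (answer X c.Tape).map fun q => ⟨q, c.Tape⟩
  else Turing.TM0.step M.machine c

/-- The result of applying the o-machine `M` with oracle `X` to the input `m`. It is undefined if
the computation does not halt. -/
noncomputable def result (M : OMachine) (X : Set ℕ) (m : ℕ) : Part ℕ :=
  (StateTransition.eval (M.step X) (Turing.TM0.init (List.replicate m stroke))).map
    fun c => unaryRead stroke c.Tape

end OMachine

/-! ### Probabilistic Turing machines -/

/-- A probabilistic Turing machine: a Turing machine with a finite alphabet `Γ` (blank `default`)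
and a finite set `Λ` of states (initial state `default`) that has a randomising state. -/
structure PTM where
  /-- tape symbols -/
  Γ : Type
  /-- states -/
  Λ : Type
  [inhabitedΓ : Inhabited Γ]
  [finiteΓ : Finite Γ]
  [inhabitedΛ : Inhabited Λ]
  [finiteΛ : Finite Λ]
  /-- the instructions, used in every state but the randomising one -/
  machine : Turing.TM0.Machine Γ Λ
  /-- the randomising state -/
  coinState : Λ
  /-- the state entered from the randomising state if the coin comes up heads -/
  headsState : Λ
  /-- the state entered from the randomising state if the coin comes up tails -/
  tailsState : Λ
  /-- the symbol that ends each number of the input -/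
  zero : Γ
  /-- the symbol in which inputs and outputs are written in unary -/
  one : Γ
  zero_ne_blank : zero ≠ default
  one_ne_blank : one ≠ default
  zero_ne_one : zero ≠ one

namespace PTM

attribute [instance] inhabitedΓ finiteΓ inhabitedΛ finiteΛ

/-- The input tape for a list of numbers: each number in unary, followed by the symbol `zero`. -/
def input (P : PTM) (l : List ℕ) : List P.Γ :=
  l.flatMap fun k => List.replicate k P.one ++ [P.zero]

open Classical in
/-- One step of the machine when the coin tosses come up as `ω 0, ω 1, …` (`true` is heads). A
configuration is paired with the number of tosses made so far. -/
noncomputable def step (P : PTM) (ω : ℕ → Bool) (c : Turing.TM0.Cfg P.Γ P.Λ × ℕ) :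
    Option (Turing.TM0.Cfg P.Γ P.Λ × ℕ) :=
  if c.1.q = P.coinState then
    some (⟨if ω c.2 then P.headsState else P.tailsState, c.1.Tape⟩, c.2 + 1)
  else (Turing.TM0.step P.machine c.1).map fun c' => (c', c.2)

/-- The output on the input `l` when the coin tosses come up as `ω`. It is undefined if the
computation does not halt. -/
noncomputable def result (P : PTM) (ω : ℕ → Bool) (l : List ℕ) : Part ℕ :=
  (StateTransition.eval (P.step ω) (Turing.TM0.init (P.input l), 0)).map
    fun c => unaryRead P.one c.1.Tape

end PTM

/-- The law of an infinite sequence of independent tosses of a coin that comes up heads with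
probability `p`. -/
noncomputable def tossMeasure (p : unitInterval) : Measure (ℕ → Bool) :=
  Measure.infinitePi fun _ => bernoulliMeasure true false p

/-! ### Sets of natural numbers as probabilities -/

open Classical in
/-- The probability `p_X = 0.d₀d₁d₂…` in binary, where `d_n` is `1` if `n ∈ X` and `0` otherwise. -/
noncomputable def codeProb (X : Set ℕ) : unitInterval :=
  ⟨Real.ofDigits (b := 2) fun n => if n ∈ X then 1 else 0,
    Real.ofDigits_nonneg _, Real.ofDigits_le_one _⟩

/-- Dyadic rationals. -/
def IsDyadic (x : ℝ) : Prop := ∃ (a : ℤ) (k : ℕ), x = a / 2 ^ k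

/-! The bias `p = p_X` is estimated from the tosses, the binary digits of `p` answer the oracle
queries, and the o-machine is simulated with these answers. In round `t` the first `N = 2 ^ (3 * t +
j)` tosses are used. By Chebyshev the frequency of heads misses `p` by `2⁻ᵗ` or more with
probability at most `2 ^ (-(t + j + 2))`. These bounds are summable, so outside an event of
probability at most `2⁻ʲ` all rounds are accurate at once (`le_tossMeasure_estimates`). Accuracy in
every round matters because a computation that does not halt goes through all of them.

A digit is used only if it is constant on the error interval, so on the good event no answer is ever
wrong (`digitEstimate_sound`). As `p` is not dyadic, `2 ^ (i + 1) * p` is not an integer, and the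
`i`-th digit is known from some round on (`digitEstimate_complete`). A halting o-computation poses
finitely many queries, so some round knows all the answers and allows enough steps
(`OMachine.exists_simulate_of_dom`). Conversely, a simulation that halts on correct answers is a
true computation (`OMachine.mem_result_of_simulate`).

The round is a primitive recursive test on the list of tosses. `PTM.exists_of_primrec` turns any
such test into a PTM: a compiled program is run after every toss, and its output, left on the tape,
says whether to toss again and serves as input to its next run. -/

/-! ### Compiling list programs to single-tape machines -/

namespace CoinMachine

open Turing StateTransition

abbrev Bit : Type := PartrecToTM2.Γ'

abbrev Symbol : Type := TM2to1.Γ' PartrecToTM2.K' fun _ => Bit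

instance : Finite PartrecToTM2.K' :=
  Finite.of_injective
    (fun k : PartrecToTM2.K' => (PartrecToTM2.K'.rec 0 1 2 3 k : Fin 4)) fun a b h => by
      cases a <;> cases b <;> first | rfl | (exact absurd h (by decide))

instance : Finite Symbol := inferInstanceAs (Finite (Bool × (PartrecToTM2.K' → Option Bit)))

/-- The content of a tape square that holds `g` on the main stack and nothing else. -/
def column (g : Bit) : PartrecToTM2.K' → Option Bit
  | .main => some g
  | _ => none

/-- A tape square, marked as the bottom of the stacks or not, that holds only `g`. -/
def cell (b : Bool) (g : Bit) : Symbol := (b, column g)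

theorem cell_injective (b : Bool) : Function.Injective (cell b) := fun _ _ e =>
  Option.some.inj (congrFun (congrArg Prod.snd e) .main)

theorem cell_ne_default (b : Bool) (g : Bit) : cell b g ≠ default := fun e =>
  Option.some_ne_none g (congrFun (congrArg Prod.snd e) .main)

/-- The tape on which the main stack is `l` and the other stacks are empty. -/
def stackTape (l : List Bit) : Tape Symbol :=
  Tape.mk' ∅ (TM2to1.addBottom (ListBlank.mk (l.reverse.map column)))

/-- The single-tape program of the evaluator of list programs. -/
abbrev program := TM2to1.tr PartrecToTM2.tr

abbrev State : Type := TM1to0.Λ' program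

/-- The single-tape evaluator of list programs. -/
def evaluator : TM0.Machine Symbol State := TM1to0.tr program

def startState (c : ToPartrec.Code) : State :=
  (some (program (.normal (PartrecToTM2.trNormal c .halt))), none)

def haltState : State := (none, none)

theorem map_proj_column (l : List Bit) (k : PartrecToTM2.K') :
    (ListBlank.mk (l.reverse.map column)).map (proj k) =
      ListBlank.mk ((PartrecToTM2.K'.elim l [] [] [] k).map some).reverse := by
  refine ListBlank.ext fun i => ?_
  rw [ListBlank.map_mk, ListBlank.nth_mk, ListBlank.nth_mk, List.getI_eq_getElem?_getD,
    List.getI_eq_getElem?_getD, List.map_map, ← List.map_reverse, List.getElem?_map,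
    List.getElem?_map]
  cases k <;> simp [proj, PointedMap.mk_val] <;> cases l.reverse[i]? <;> rfl

/-- The simulation of stacks on one tape specifies the tape only through its projections to the
single stacks; jointly they determine it. -/
theorem eq_column_of_map_proj {L : ListBlank (PartrecToTM2.K' → Option Bit)} {l : List Bit}
    (h : ∀ k, L.map (proj k) =
      ListBlank.mk ((PartrecToTM2.K'.elim l [] [] [] k).map some).reverse) :
    L = ListBlank.mk (l.reverse.map column) := by
  refine ListBlank.ext fun i => funext fun k => ?_
  rw [← proj_map_nth, ← proj_map_nth, h, map_proj_column]

/-- Composes the simulation of list programs by a stack machine with its reductions to `TM1` and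
`TM0`. -/
theorem evaluator_reaches {c : ToPartrec.Code} {v w : List ℕ} (h : w ∈ c.eval v) :
    Reaches (TM0.step evaluator) ⟨startState c, stackTape (PartrecToTM2.trList v)⟩
      ⟨haltState, stackTape (PartrecToTM2.trList w)⟩ := by
  have h2 : PartrecToTM2.halt w ∈
      eval (TM2.step PartrecToTM2.tr) (PartrecToTM2.init c v) := by
    rw [PartrecToTM2.tr_eval]
    exact Part.mem_map _ h
  obtain ⟨c1, hc1, h1⟩ := StateTransition.tr_eval (TM2to1.tr_respects PartrecToTM2.tr)
    (TM2to1.TrCfg.mk _ (map_proj_column (PartrecToTM2.trList v))) h2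
  obtain ⟨c0, hc0, h0⟩ := StateTransition.tr_eval (TM1to0.tr_respects program) rfl h1
  rcases hc1 with ⟨L, hL⟩
  rw [eq_column_of_map_proj hL] at hc0
  subst hc0
  exact (mem_eval.1 h0).1

/-- `State` covers the programs of all codes at once, while a PTM needs a finite state set. -/
theorem exists_finite_support (c : ToPartrec.Code) :
    ∃ S : Set State, S.Finite ∧ startState c ∈ S ∧
      ∀ q a q' s, evaluator q a = some (q', s) → q ∈ S → q' ∈ S := by
  -- The support theorems speak of the default label, so the default is made the entry point of `c`.
  let _ : Inhabited PartrecToTM2.Λ' := ⟨PartrecToTM2.trNormal c .halt⟩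
  have h2 := PartrecToTM2.tr_supports c .halt
  have h1 := TM2to1.tr_supports PartrecToTM2.tr h2
  have h0 := TM1to0.tr_supports program h1
  exact ⟨_, Finset.finite_toSet _, h0.1, fun q a q' s e hq => h0.2 e hq⟩

end CoinMachine

/-! ### Reading unary numbers and running machines step by step -/

theorem unaryRead_mk' {Γ : Type} [Inhabited Γ] [DecidableEq Γ] {one : Γ} (hone : one ≠ default)
    (L : Turing.ListBlank Γ) (l : List Γ) :
    unaryRead one (Turing.Tape.mk' L (Turing.ListBlank.mk l)) =
      (l.takeWhile (· = one)).length := by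
  unfold unaryRead
  simp only [Turing.Tape.mk'_nth_nat, Turing.ListBlank.nth_mk]
  have key : ∀ l : List Γ, l.getI (l.takeWhile (· = one)).length ≠ one ∧
      ∀ i < (l.takeWhile (· = one)).length, l.getI i = one := by
    intro l
    induction l with
    | nil => exact ⟨by simpa [List.getI] using hone.symm, by simp⟩
    | cons a l ih =>
      by_cases h : a = one
      · rw [List.takeWhile_cons_of_pos (by simpa using h)]
        refine ⟨ih.1, fun i hi => ?_⟩
        cases i with
        | zero => exact h
        | succ i => exact ih.2 i (Nat.lt_of_succ_lt_succ hi)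
      · rw [List.takeWhile_cons_of_neg (by simpa using h)]
        exact ⟨h, by simp⟩
  refine le_antisymm (Nat.sInf_le (key l).1) (le_csInf ⟨_, (key l).1⟩ fun i hi => ?_)
  by_contra! h
  exact hi ((key l).2 i h)

namespace StateTransition

/-- Induction along a halting run: if `a` reaches some `c k`, its successor reaches `c (k + 1)`, so
no configuration of the run can reach the sequence, not even the first. -/
theorem not_dom_eval_of_reaches₁ {σ : Type*} {f : σ → Option σ} (c : ℕ → σ)
    (h : ∀ k, Reaches₁ f (c k) (c (k + 1))) : ¬ (eval f (c 0)).Dom := by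
  intro hd
  refine evalInduction (C := fun a => ∀ k, ¬ Reaches f a (c k)) ⟨hd, rfl⟩ (fun a _ ih k hk => ?_)
    0 Relation.ReflTransGen.refl
  have h1 : Reaches₁ f a (c (k + 1)) := Relation.TransGen.trans_right hk (h k)
  obtain ⟨a', ha, hr⟩ := Relation.TransGen.head'_iff.1 h1
  exact ih a' ha _ hr

end StateTransition

/-! ### Alternating runs of a list program with coin tosses. -/

namespace CoinMachine

open Turing StateTransition

/-- The tape shows the last list entry first, after the bottom cell, with its most significant bit
leading. `start` and `mark` add the bottom cell; `skip` and `test` inspect the second bit of that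
entry: `bit0` demands a toss, otherwise `done` stops on the output. After the toss, `heads` turns
the bit into `bit1`, while tails leaves it; `back` and `rewind` return to the bottom cell. -/
inductive Control
  | start | mark | skip | test | toss | heads | back | rewind | done
  deriving Inhabited, DecidableEq

instance : Finite Control :=
  Finite.of_injective
    (fun k : Control => (Control.rec 0 1 2 3 4 5 6 7 8 k : Fin 9)) fun a b h => by
      cases a <;> cases b <;> first | rfl | (exact absurd h (by decide))

/-- A finite set of states of the evaluator that is closed under the runs of `c`. -/
noncomputable def support (c : ToPartrec.Code) : Set State := (exists_finite_support c).choose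

instance (c : ToPartrec.Code) : Finite (support c) := (exists_finite_support c).choose_spec.1

theorem startState_mem (c : ToPartrec.Code) : startState c ∈ support c :=
  (exists_finite_support c).choose_spec.2.1

theorem support_closed {c : ToPartrec.Code} {q a q' s} (h : evaluator q a = some (q', s))
    (hq : q ∈ support c) : q' ∈ support c :=
  (exists_finite_support c).choose_spec.2.2 q a q' s h hq

instance (c : ToPartrec.Code) : Inhabited (Control ⊕ support c) := ⟨.inl .start⟩

open Classical in
noncomputable def embed (c : ToPartrec.Code) (q : State) : Control ⊕ support c :=
  -- The value outside the support is never met in a run from `startState c`.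
  if h : q ∈ support c then .inr ⟨q, h⟩ else default

theorem embed_of_mem {c : ToPartrec.Code} {q : State} (h : q ∈ support c) :
    embed c q = .inr ⟨q, h⟩ := dif_pos h

open Classical in
/-- The instructions of the machine that runs `c` again and again, tossing the coin after each run
whose output demands it. -/
noncomputable def instruction (c : ToPartrec.Code) :
    TM0.Machine Symbol (Control ⊕ support c)
  | .inl .start, _ => some (.inl .mark, .move .left)
  | .inl .mark, _ => some (embed c (startState c), .write (cell true .cons))
  | .inl .skip, _ => some (.inl .test, .move .right)
  | .inl .test, a =>
    if a = cell false .bit0 then some (.inl .toss, .write a) else some (.inl .done, .move .right)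
  | .inl .toss, _ => none
  | .inl .heads, _ => some (.inl .back, .write (cell false .bit1))
  | .inl .back, _ => some (.inl .rewind, .move .left)
  | .inl .rewind, _ => some (embed c (startState c), .move .left)
  | .inl .done, _ => none
  | .inr q, a => match evaluator q.1 a with
    | some (q', s) => some (embed c q', s)
    | none => some (.inl .skip, .move .right)

/-- The probabilistic machine that runs `c` again and again. -/
noncomputable def coinMachine (c : ToPartrec.Code) : PTM where
  Γ := Symbol
  Λ := Control ⊕ support c
  machine := instruction c
  coinState := .inl .toss
  headsState := .inl .heads
  tailsState := .inl .back
  zero := cell false .cons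
  one := cell false .bit1
  zero_ne_blank := cell_ne_default _ _
  one_ne_blank := cell_ne_default _ _
  zero_ne_one := fun h => by cases cell_injective _ h

/-- The configuration in the state `q` on the tape `T` after `k` tosses. -/
abbrev cfg (c : ToPartrec.Code) (q : Control ⊕ support c) (T : Tape Symbol) (k : ℕ) :
    TM0.Cfg (coinMachine c).Γ (coinMachine c).Λ × ℕ := (⟨q, T⟩, k)

/-- The effect of an action on the tape. -/
def act (T : Tape Symbol) : TM0.Stmt Symbol → Tape Symbol
  | .move d => T.move d
  | .write a => T.write a

theorem step_of_ne (c : ToPartrec.Code) (ω : ℕ → Bool) {q : Control ⊕ support c} {T : Tape Symbol}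
    {k : ℕ} (hq : q ≠ .inl .toss) :
    (coinMachine c).step ω (cfg c q T k) = (instruction c q T.head).map fun p =>
      cfg c p.1 (act T p.2) k := by
  refine (if_neg hq).trans ?_
  change Option.map _ (Option.map _ (instruction c q T.head)) = _
  rcases instruction c q T.head with _ | ⟨q', _ | _⟩ <;> rfl

theorem step_toss (c : ToPartrec.Code) (ω : ℕ → Bool) (T : Tape Symbol) (k : ℕ) :
    (coinMachine c).step ω (cfg c (.inl .toss) T k) =
      some (cfg c (if ω k then .inl .heads else .inl .back) T (k + 1)) := by
  refine (if_pos rfl).trans ?_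
  cases ω k <;> rfl

theorem reaches_embed {c : ToPartrec.Code} (ω : ℕ → Bool) (k : ℕ) {a b : TM0.Cfg Symbol State}
    (ha : a.q ∈ support c) (h : Reaches (TM0.step evaluator) a b) :
    b.q ∈ support c ∧ Reaches ((coinMachine c).step ω) (cfg c (embed c a.q) a.Tape k)
      (cfg c (embed c b.q) b.Tape k) := by
  induction h with
  | refl => exact ⟨ha, Relation.ReflTransGen.refl⟩
  | @tail d e _ hde ih =>
    obtain ⟨hd, hr⟩ := ih
    obtain ⟨⟨q', s⟩, hs, rfl⟩ := Option.map_eq_some_iff.1 hde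
    refine ⟨support_closed hs hd, hr.tail ?_⟩
    rw [embed_of_mem hd, step_of_ne c ω (by simp)]
    simp only [instruction, hs]
    cases s <;> rfl

theorem reaches_skip {c : ToPartrec.Code} (ω : ℕ → Bool) (k : ℕ) {v w : List ℕ}
    (h : w ∈ c.eval v) :
    Reaches ((coinMachine c).step ω)
      (cfg c (embed c (startState c)) (stackTape (PartrecToTM2.trList v)) k)
      (cfg c (.inl .skip) ((stackTape (PartrecToTM2.trList w)).move .right) k) := by
  obtain ⟨hm, hr⟩ := reaches_embed ω k (startState_mem c) (evaluator_reaches h)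
  refine hr.tail ?_
  rw [embed_of_mem hm, step_of_ne c ω (by simp)]
  rfl

theorem stackTape_eq {l : List Bit} {g : Bit} {w : List Bit} (h : l.reverse = g :: w) :
    stackTape l = Tape.mk' ∅ (ListBlank.mk (cell true g :: w.map (cell false))) := by
  have e : (w.map column).map (Prod.mk false) = w.map (cell false) := by
    rw [List.map_map]; rfl
  rw [stackTape, h, TM2to1.addBottom, List.map_cons, ListBlank.head_mk, ListBlank.tail_mk,
    ListBlank.map_mk]
  exact congrArg (fun x => Tape.mk' ∅ (ListBlank.mk (cell true g :: x))) e

/-- The input is already in stack format except for its bottom cell, which is written on the blank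
square to its left. -/
theorem reaches_of_input {c : ToPartrec.Code} (ω : ℕ → Bool) {l w : List Bit}
    (h : l.reverse = .cons :: w) :
    Reaches ((coinMachine c).step ω) (TM0.init (w.map (cell false)), 0)
      (cfg c (embed c (startState c)) (stackTape l) 0) := by
  refine .tail (b := cfg c (.inl .mark) ((Tape.mk₁ (w.map (cell false))).move .left) 0)
    (.single ?_) ?_
  · exact step_of_ne c ω (q := .inl .start) (by simp)
  · rw [step_of_ne c ω (by simp), stackTape_eq h]
    simp only [instruction, Option.mem_def, Option.map_some, Tape.mk₁, Tape.mk₂, act,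
      Tape.move_left_mk', Tape.write_mk', ListBlank.cons_mk]
    rfl

theorem move_right_mk {Γ : Type*} [Inhabited Γ] (L : List Γ) (a : Γ) (R : List Γ) :
    (Tape.mk' (ListBlank.mk L) (ListBlank.mk (a :: R))).move .right =
      Tape.mk' (ListBlank.mk (a :: L)) (ListBlank.mk R) := by
  rw [Tape.move_right_mk', ListBlank.head_mk, ListBlank.tail_mk, ListBlank.cons_mk]; rfl

theorem move_left_mk {Γ : Type*} [Inhabited Γ] (L : List Γ) (a : Γ) (R : List Γ) :
    (Tape.mk' (ListBlank.mk (a :: L)) (ListBlank.mk R)).move .left =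
      Tape.mk' (ListBlank.mk L) (ListBlank.mk (a :: R)) := by
  rw [Tape.move_left_mk', ListBlank.head_mk, ListBlank.tail_mk, ListBlank.cons_mk]; rfl

theorem write_mk {Γ : Type*} [Inhabited Γ] (L : List Γ) (a b : Γ) (R : List Γ) :
    (Tape.mk' (ListBlank.mk L) (ListBlank.mk (a :: R))).write b =
      Tape.mk' (ListBlank.mk L) (ListBlank.mk (b :: R)) := by
  rw [Tape.write_mk', ListBlank.tail_mk, ListBlank.cons_mk]; rfl

/-- The part of the run between a demand for a coin toss and the next run of `c`. -/
theorem reaches_toss (c : ToPartrec.Code) (ω : ℕ → Bool) (k : ℕ) {l l' : List Bit}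
    {w : List Bit} (h : l.reverse = .cons :: .bit1 :: .bit0 :: w)
    (h' : l'.reverse = .cons :: .bit1 :: (if ω k then .bit1 else .bit0) :: w) :
    Reaches₁ ((coinMachine c).step ω) (cfg c (.inl .skip) ((stackTape l).move .right) k)
      (cfg c (embed c (startState c)) (stackTape l') (k + 1)) := by
  rw [stackTape_eq h, stackTape_eq h']
  have e : (∅ : ListBlank Symbol) = ListBlank.mk [] := rfl
  simp only [e, List.map_cons, move_right_mk]
  generalize w.map (cell false) = R
  refine .head (b := cfg c (.inl .test) (Tape.mk' (ListBlank.mk [cell false .bit1, cell true .cons])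
    (ListBlank.mk (cell false .bit0 :: R))) k) ?_ ?_
  · rw [step_of_ne c ω (by simp)]
    simp only [instruction, Option.mem_def, Option.map_some, act, move_right_mk]
  refine .head (b := cfg c (.inl .toss) (Tape.mk' (ListBlank.mk [cell false .bit1, cell true .cons])
    (ListBlank.mk (cell false .bit0 :: R))) k) ?_ ?_
  · rw [step_of_ne c ω (by simp)]
    simp only [instruction, Option.mem_def, Tape.mk'_head, ListBlank.head_mk, List.headI,
      if_true, Option.map_some, act, write_mk]
  -- Both outcomes share the way back; heads only overwrites the bit before.
  have rewind : ∀ g, Reaches₁ ((coinMachine c).step ω)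
      (cfg c (.inl .back) (Tape.mk' (ListBlank.mk [cell false .bit1, cell true .cons])
        (ListBlank.mk (cell false g :: R))) (k + 1))
      (cfg c (embed c (startState c)) (Tape.mk' (ListBlank.mk [])
        (ListBlank.mk (cell true .cons :: cell false .bit1 :: cell false g :: R))) (k + 1)) := by
    intro g
    refine .head (b := cfg c (.inl .rewind) (Tape.mk' (ListBlank.mk [cell true .cons])
      (ListBlank.mk (cell false .bit1 :: cell false g :: R))) (k + 1)) ?_ (.single ?_)
    · rw [step_of_ne c ω (by simp)]
      simp only [instruction, Option.mem_def, Option.map_some, act, move_left_mk]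
    · rw [step_of_ne c ω (by simp)]
      simp only [instruction, Option.mem_def, Option.map_some, act, move_left_mk]
  refine .head (step_toss c ω _ k) ?_
  cases ω k with
  | false => exact rewind _
  | true =>
    refine .head ?_ (rewind _)
    rw [if_pos rfl, step_of_ne c ω (by simp)]
    simp only [instruction, Option.mem_def, Option.map_some, act, write_mk, if_true]

/-- The end of the run, after `c` has produced an output that demands no coin toss. -/
theorem mem_result_of_output {c : ToPartrec.Code} {ω : ℕ → Bool} {k : ℕ} {l : List Bit} {r : ℕ}
    {w : List Bit} {x : List ℕ}
    (h : l.reverse = .cons :: .bit1 :: .bit1 :: (List.replicate r .bit1 ++ w))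
    (hw : w.head? ≠ some .bit1)
    (hr : Reaches ((coinMachine c).step ω) (TM0.init ((coinMachine c).input x), 0)
      (cfg c (.inl .skip) ((stackTape l).move .right) k)) :
    r ∈ (coinMachine c).result ω x := by
  classical
  have e : (∅ : ListBlank Symbol) = ListBlank.mk [] := rfl
  rw [stackTape_eq h] at hr
  simp only [e, List.map_cons, move_right_mk] at hr
  refine (Part.mem_map_iff _).2 ⟨cfg c (.inl .done) (Tape.mk' (ListBlank.mk
    [cell false .bit1, cell false .bit1, cell true .cons])
    (ListBlank.mk ((List.replicate r PartrecToTM2.Γ'.bit1 ++ w).map (cell false)))) k, mem_eval.2 ⟨?_, ?_⟩, ?_⟩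
  · refine (hr.tail (c := cfg c (.inl .test) (Tape.mk' (ListBlank.mk
      [cell false .bit1, cell true .cons]) (ListBlank.mk (cell false .bit1 ::
        (List.replicate r PartrecToTM2.Γ'.bit1 ++ w).map (cell false)))) k) ?_).tail ?_
    · rw [step_of_ne c ω (by simp)]
      simp only [instruction, Option.mem_def, Option.map_some, act, move_right_mk]
    · rw [step_of_ne c ω (by simp)]
      simp only [instruction, Option.mem_def, Tape.mk'_head, ListBlank.head_mk, List.headI,
        (cell_injective false).eq_iff, reduceCtorEq, if_false, Option.map_some, act, move_right_mk]
  · rw [step_of_ne c ω (by simp)]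
    rfl
  · change unaryRead (cell false .bit1) (Tape.mk' _ _) = r
    rw [unaryRead_mk' (cell_ne_default _ _), List.takeWhile_map, List.length_map]
    have : ∀ g, ((fun a => decide (a = cell false .bit1)) ∘ cell false) g =
        decide (g = (.bit1 : Bit)) := fun g => by simp [(cell_injective false).eq_iff]
    rw [funext this, List.takeWhile_append_of_pos (by simp)]
    cases w with
    | nil => simp
    | cons a w => simpa using hw

end CoinMachine

/-! ### Running a primitive recursive test on the tosses made so far -/

theorem Primrec.nat_pow : Primrec₂ ((· ^ ·) : ℕ → ℕ → ℕ) :=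
  Primrec₂.unpaired'.1 Nat.Primrec.pow

namespace CoinMachine

open Turing StateTransition

theorem trNat_bit1 (n : ℕ) :
    PartrecToTM2.trNat (2 * n + 1) = .bit1 :: PartrecToTM2.trNat n := by
  have : ((2 * n + 1 : ℕ) : Num) = Num.bit1 n := by
    push_cast
    rw [two_mul, Num.bit1_of_bit1]
  rw [PartrecToTM2.trNat, PartrecToTM2.trNat, this]
  cases (n : Num) <;> rfl

theorem trNat_two : PartrecToTM2.trNat 2 = [.bit0, .bit1] := rfl

theorem trNat_three : PartrecToTM2.trNat 3 = [.bit1, .bit1] := rfl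

/-- A unary block of length `r` is the binary numeral of `2 ^ r - 1`; hence unary inputs and outputs
need no conversion on the tape. -/
theorem trNat_two_pow_sub_one (r : ℕ) :
    PartrecToTM2.trNat (2 ^ r - 1) = List.replicate r .bit1 := by
  induction r with
  | zero => exact PartrecToTM2.trNat_zero
  | succ r ih =>
    have := Nat.one_le_two_pow (n := r)
    rw [show 2 ^ (r + 1) - 1 = 2 * (2 ^ r - 1) + 1 by omega, trNat_bit1, ih, List.replicate_succ]

/-- The input of the test: the input numbers and the tosses made so far, the latest first. -/
abbrev Situation : Type := (ℕ × ℕ × ℕ) × List Bool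

/-- The least exponent `i` with `x < 2 ^ i`. -/
def bitLength (x : ℕ) : ℕ := (List.range (x + 1)).findIdx fun i => decide (x < 2 ^ i)

theorem bitLength_two_pow_sub_one (r : ℕ) : bitLength (2 ^ r - 1) = r := by
  have h1 := Nat.one_le_two_pow (n := r)
  have h2 := Nat.lt_two_pow_self (n := r)
  refine (List.findIdx_eq (by simp; omega)).2 ⟨by simp, fun i hi => ?_⟩
  have := Nat.pow_lt_pow_right one_lt_two hi
  simp; omega

theorem primrec_bitLength : Primrec bitLength :=
  Primrec.list_findIdx (Primrec.list_range.comp Primrec.succ)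
    (Primrec.nat_lt.decide.comp Primrec.fst (Primrec.nat_pow.comp (Primrec.const 2) Primrec.snd))

/-- The list on which the machine calls its program to test the situation `s`. -/
def report (F : Situation → Option ℕ) (s : Situation) : List ℕ :=
  [Encodable.encode s + 1, 0, 0, (F s).elim 2 fun r => 2 ^ (r + 2) - 1]

def decodeSituation (e : ℕ) : Situation := (Encodable.decode e).getD default

theorem decodeSituation_encode (s : Situation) : decodeSituation (Encodable.encode s) = s := by
  rw [decodeSituation, Encodable.encodek, Option.getD_some]

/-- The situation that follows the situation reported in the first entry, if there is one, after a
toss encoded by the last one. -/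
def nextSituation (v : List.Vector ℕ 4) : Situation :=
  if v.get 0 = 0 then ((bitLength (v.get 3), bitLength (v.get 2), bitLength (v.get 1)), [])
  else ((decodeSituation (v.get 0 - 1)).1,
    decide (v.get 3 = 3) :: (decodeSituation (v.get 0 - 1)).2)

theorem primrec_nextSituation : Primrec nextSituation := by
  have g : ∀ i : Fin 4, Primrec fun v : List.Vector ℕ 4 => v.get i := fun i =>
    Primrec.vector_get.comp .id (.const i)
  have l : ∀ i : Fin 4, Primrec fun v : List.Vector ℕ 4 => bitLength (v.get i) := fun i =>
    primrec_bitLength.comp (g i)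
  have d : Primrec fun v : List.Vector ℕ 4 => decodeSituation (v.get 0 - 1) :=
    Primrec.option_getD.comp (Primrec.decode.comp (Primrec.pred.comp (g 0))) (.const _)
  exact Primrec.ite (Primrec.eq.comp (g 0) (.const 0))
    (((l 3).pair ((l 2).pair (l 1))).pair (.const []))
    ((Primrec.fst.comp d).pair (Primrec.list_cons.comp
      (Primrec.eq.decide.comp (g 3) (.const 3)) (Primrec.snd.comp d)))

theorem exists_program {F : Situation → Option ℕ} (hF : Primrec F) :
    ∃ c : ToPartrec.Code, ∀ v : List.Vector ℕ 4,
      report F (nextSituation v) ∈ c.eval v.1 := by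
  have h1 : Primrec fun v : List.Vector ℕ 4 => Encodable.encode (nextSituation v) + 1 :=
    Primrec.succ.comp (Primrec.encode.comp primrec_nextSituation)
  have h2 : Primrec fun v : List.Vector ℕ 4 =>
      (F (nextSituation v)).elim 2 fun r => 2 ^ (r + 2) - 1 :=
    (Primrec.option_casesOn (hF.comp primrec_nextSituation) (.const 2)
      (Primrec.nat_sub.comp (Primrec.nat_pow.comp (.const 2)
        (Primrec.nat_add.comp Primrec.snd (.const 2))) (.const 1)).to₂).of_eq fun v => by
      cases F (nextSituation v) <;> rfl
  obtain ⟨c1, hc1⟩ := ToPartrec.Code.exists_code (Nat.Partrec'.of_part h1.to_comp.partrec)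
  obtain ⟨c2, hc2⟩ := ToPartrec.Code.exists_code (Nat.Partrec'.of_part h2.to_comp.partrec)
  -- The two zeros pad the output to the four entries that the next call expects.
  refine ⟨.cons c1 (.cons .zero (.cons .zero c2)), fun v => ?_⟩
  have e1 := hc1 v
  have e2 := hc2 v
  simp [e1, e2, report]

/-- The first `k` tosses, the latest first. -/
def tosses (ω : ℕ → Bool) : ℕ → List Bool
  | 0 => []
  | k + 1 => ω k :: tosses ω k

/-- The machine whose program is `c`, when it is about to decide whether to toss the coin after
`k` tosses. -/
noncomputable def reportCfg (c : ToPartrec.Code) (F : Situation → Option ℕ) (ω : ℕ → Bool)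
    (x : ℕ × ℕ × ℕ) (k : ℕ) : TM0.Cfg (coinMachine c).Γ (coinMachine c).Λ × ℕ :=
  cfg c (.inl .skip)
    ((stackTape (PartrecToTM2.trList (report F (x, tosses ω k)))).move .right) k

section

variable {F : Situation → Option ℕ} {c : ToPartrec.Code}
  (hc : ∀ v : List.Vector ℕ 4, report F (nextSituation v) ∈ c.eval v.1)

include hc

theorem reaches_first_report (ω : ℕ → Bool) (j n m : ℕ) :
    Reaches ((coinMachine c).step ω) (TM0.init ((coinMachine c).input [j, n, m]), 0)
      (reportCfg c F ω (j, n, m) 0) := by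
  -- The order is reversed because the tape carries the stack bottom first. The leading `0` comes
  -- from the separator after `m` and marks the first call; later calls have an encoding plus one
  -- there.
  have e := hc ⟨[0, 2 ^ m - 1, 2 ^ n - 1, 2 ^ j - 1], rfl⟩
  have hs : nextSituation ⟨[0, 2 ^ m - 1, 2 ^ n - 1, 2 ^ j - 1], rfl⟩ = ((j, n, m), []) := by
    simp [nextSituation, List.Vector.get, bitLength_two_pow_sub_one]
  rw [hs] at e
  refine Relation.ReflTransGen.trans ?_ (reaches_skip ω 0 e)
  have := reaches_of_input (c := c) ω (l := PartrecToTM2.trList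
    [0, 2 ^ m - 1, 2 ^ n - 1, 2 ^ j - 1]) (w := List.replicate j .bit1 ++ .cons ::
      (List.replicate n .bit1 ++ .cons :: (List.replicate m .bit1 ++ [.cons])))
      (by simp [trNat_two_pow_sub_one])
  have hi : (coinMachine c).input [j, n, m] = List.map (cell false)
      (List.replicate j .bit1 ++ .cons :: (List.replicate n .bit1 ++ .cons ::
        (List.replicate m .bit1 ++ [.cons]))) := by
    change List.flatMap (fun k => List.replicate k (cell false .bit1) ++ [cell false .cons]) _ = _
    simp
  rw [hi]
  exact this

theorem reaches_next_report (ω : ℕ → Bool) (x : ℕ × ℕ × ℕ) (k : ℕ)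
    (h : F (x, tosses ω k) = none) :
    Reaches₁ ((coinMachine c).step ω) (reportCfg c F ω x k) (reportCfg c F ω x (k + 1)) := by
  -- The report ends in `2`, binary `10`; heads changes its last bit and makes it `3`.
  let b : ℕ := if ω k then 3 else 2
  have e := hc ⟨[Encodable.encode (x, tosses ω k) + 1, 0, 0, b], rfl⟩
  have hs : nextSituation ⟨[Encodable.encode (x, tosses ω k) + 1, 0, 0, b], rfl⟩ =
      (x, tosses ω (k + 1)) := by
    cases hω : ω k <;>
    simp [nextSituation, List.Vector.get, decodeSituation_encode, -Encodable.encode_prod_val, tosses, b, hω]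
  rw [hs] at e
  refine Relation.TransGen.trans_left ?_ (reaches_skip ω (k + 1) e)
  refine reaches_toss c ω k (w := .cons :: .cons :: .cons ::
    (PartrecToTM2.trNat (Encodable.encode (x, tosses ω k) + 1)).reverse) ?_ ?_
  · simp [report, h, trNat_two]
  · cases hω : ω k <;> simp [b, hω, trNat_two, trNat_three]

theorem mem_result_of_report (ω : ℕ → Bool) {j n m k r : ℕ}
    (h : F ((j, n, m), tosses ω k) = some r) (hk : ∀ i < k, F ((j, n, m), tosses ω i) = none) :
    r ∈ (coinMachine c).result ω [j, n, m] := by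
  have hr : ∀ i ≤ k, Reaches ((coinMachine c).step ω)
      (TM0.init ((coinMachine c).input [j, n, m]), 0) (reportCfg c F ω (j, n, m) i) := by
    intro i
    induction i with
    | zero => exact fun _ => reaches_first_report hc ω j n m
    | succ i ih =>
      exact fun hi => (ih (by omega)).trans
        (reaches_next_report hc ω _ i (hk i (by omega))).to_reflTransGen
  refine mem_result_of_output (w := .cons :: .cons :: .cons ::
    (PartrecToTM2.trNat (Encodable.encode ((j, n, m), tosses ω k) + 1)).reverse) ?_ (by simp)
    (hr k le_rfl)
  have hb : (PartrecToTM2.trNat (2 ^ (r + 2) - 1)).reverse =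
      .bit1 :: .bit1 :: List.replicate r .bit1 := by
    rw [trNat_two_pow_sub_one, List.reverse_replicate]; rfl
  simp [report, h, hb]

theorem result_eq_none_of_report (ω : ℕ → Bool) {j n m : ℕ}
    (h : ∀ k, F ((j, n, m), tosses ω k) = none) :
    (coinMachine c).result ω [j, n, m] = Part.none := by
  rw [Part.eq_none_iff']
  intro hd
  have hd' : (eval ((coinMachine c).step ω)
    (TM0.init ((coinMachine c).input [j, n, m]), 0)).Dom := hd
  rw [reaches_eval (reaches_first_report hc ω j n m)] at hd'
  exact not_dom_eval_of_reaches₁ _ (fun k => reaches_next_report hc ω _ k (h k)) hd'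

end

end CoinMachine

/-- For every primitive recursive test `F` there is a probabilistic machine that tosses the coin
until `F` accepts the tosses made so far, and outputs what `F` returns. -/
theorem PTM.exists_of_primrec {F : (ℕ × ℕ × ℕ) × List Bool → Option ℕ} (hF : Primrec F) :
    ∃ P : PTM, ∀ (ω : ℕ → Bool) (j n m : ℕ),
      (∀ r k, F ((j, n, m), CoinMachine.tosses ω k) = some r →
        (∀ i < k, F ((j, n, m), CoinMachine.tosses ω i) = none) →
        r ∈ P.result ω [j, n, m]) ∧
      ((∀ k, F ((j, n, m), CoinMachine.tosses ω k) = none) →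
        P.result ω [j, n, m] = Part.none) := by
  obtain ⟨c, hc⟩ := CoinMachine.exists_program hF
  exact ⟨CoinMachine.coinMachine c, fun ω j n m =>
    ⟨fun r k h hk => CoinMachine.mem_result_of_report hc ω h hk,
      fun h => CoinMachine.result_eq_none_of_report hc ω h⟩⟩

/-! ### Estimating the bias of the coin -/

instance (p : unitInterval) : IsProbabilityMeasure (tossMeasure p) := by
  unfold tossMeasure; infer_instance

/-- The number of heads in a list of tosses. -/
def headCount (l : List Bool) : ℕ := l.count true

theorem headCount_tosses (ω : ℕ → Bool) (N : ℕ) :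
    (headCount (CoinMachine.tosses ω N) : ℝ) = ∑ i ∈ Finset.range N, if ω i then 1 else 0 := by
  induction N with
  | zero => simp [headCount, CoinMachine.tosses]
  | succ N ih =>
    rw [Finset.sum_range_succ, ← ih]
    cases h : ω N <;> simp [headCount, CoinMachine.tosses, h]

section

variable (p : unitInterval)

theorem integral_toss (i : ℕ) :
    ∫ ω, (if ω i then (1 : ℝ) else 0) ∂tossMeasure p = p := by
  have h : MeasurePreserving (fun ω : ℕ → Bool => ω i) (tossMeasure p)
      (bernoulliMeasure true false p) :=
    measurePreserving_eval_infinitePi (fun _ : ℕ => bernoulliMeasure true false p) i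
  have e := integral_map (μ := tossMeasure p) (φ := fun ω : ℕ → Bool => ω i)
    (f := fun b : Bool => if b then (1 : ℝ) else 0) h.measurable.aemeasurable
    Measurable.of_discrete.aestronglyMeasurable
  rw [← e, h.map_eq, integral_bernoulliMeasure]
  simp

theorem measurable_toss (i : ℕ) : Measurable fun ω : ℕ → Bool => if ω i then (1 : ℝ) else 0 :=
  (Measurable.of_discrete (f := fun b : Bool => if b then (1 : ℝ) else 0)).comp
    (measurable_pi_apply i)

theorem memLp_toss (i : ℕ) :
    MemLp (fun ω : ℕ → Bool => if ω i then (1 : ℝ) else 0) 2 (tossMeasure p) :=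
  MemLp.of_bound (measurable_toss i).aestronglyMeasurable 1
    (Filter.Eventually.of_forall fun ω => by split_ifs <;> simp)

/-- Variances of independent tosses add, and a variable with values in `[0, 1]` has variance at most
`1 / 4`. -/
theorem variance_sum_toss_le (N : ℕ) :
    variance (∑ i ∈ Finset.range N, fun ω : ℕ → Bool => if ω i then (1 : ℝ) else 0)
      (tossMeasure p) ≤ N / 4 := by
  have hi : iIndepFun (fun i (ω : ℕ → Bool) => if ω i then (1 : ℝ) else 0) (tossMeasure p) :=
    iIndepFun_infinitePi (P := fun _ => bernoulliMeasure true false p)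
      (X := fun _ b => if b then (1 : ℝ) else 0) (fun _ => Measurable.of_discrete)
  rw [IndepFun.variance_sum (fun i _ => memLp_toss p i) fun i _ j _ hij => hi.indepFun hij]
  refine (Finset.sum_le_card_nsmul _ _ (1 / 4) fun i _ => ?_).trans (by simp; linarith)
  refine (variance_le_sq_of_bounded (a := 0) (b := 1) (Filter.Eventually.of_forall fun ω => ?_)
    (measurable_toss i).aemeasurable).trans (by norm_num)
  split_ifs <;> simp

theorem tossMeasure_deviation_le (N : ℕ) {c : ℝ} (hc : 0 < c) :
    tossMeasure p {ω | c ≤ |headCount (CoinMachine.tosses ω N) - N * (p : ℝ)|} ≤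
      ENNReal.ofReal (N / 4 / c ^ 2) := by
  have h := meas_ge_le_variance_div_sq (μ := tossMeasure p)
    (memLp_finsetSum' (Finset.range N) fun i _ => memLp_toss p i) hc
  have e : ∫ ω, (∑ i ∈ Finset.range N, fun ω : ℕ → Bool => if ω i then (1 : ℝ) else 0) ω
      ∂tossMeasure p = N * p := by
    simp only [Finset.sum_apply]
    rw [integral_finsetSum _ fun i _ => (memLp_toss p i).integrable (by norm_num)]
    simp [integral_toss]
  rw [e] at h
  simp only [headCount_tosses]
  simp only [Finset.sum_apply] at h
  refine h.trans (ENNReal.ofReal_le_ofReal ?_)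
  gcongr
  exact variance_sum_toss_le p N

/-- The number of tosses used in the `t`-th estimate of the bias. -/
def sampleSize (j t : ℕ) : ℕ := 2 ^ (3 * t + j)

theorem le_tossMeasure_estimates (j : ℕ) :
    1 - 1 / 2 ^ j ≤ (tossMeasure p).real {ω | ∀ t,
      |(headCount (CoinMachine.tosses ω (sampleSize j t)) : ℝ) - sampleSize j t * (p : ℝ)| <
        2 ^ (2 * t + j)} := by
  set G := {ω : ℕ → Bool | ∀ t,
      |(headCount (CoinMachine.tosses ω (sampleSize j t)) : ℝ) - sampleSize j t * (p : ℝ)| <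
        2 ^ (2 * t + j)}
  have hG : MeasurableSet G := by
    rw [show G = ⋂ t, {ω | |(headCount (CoinMachine.tosses ω (sampleSize j t)) : ℝ) -
      sampleSize j t * (p : ℝ)| < 2 ^ (2 * t + j)} by ext ω; simp [G]]
    refine MeasurableSet.iInter fun t => measurableSet_lt ?_ measurable_const
    simp only [headCount_tosses]
    exact ((Finset.measurable_fun_sum _ fun i _ => measurable_toss i).sub_const _).abs
  have hc : tossMeasure p Gᶜ ≤ ENNReal.ofReal (1 / 2 ^ j) := by
    have e : Gᶜ = ⋃ t, {ω | (2 : ℝ) ^ (2 * t + j) ≤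
        |headCount (CoinMachine.tosses ω (sampleSize j t)) - sampleSize j t * (p : ℝ)|} := by
      ext ω; simp [G]
    rw [e]
    refine (measure_iUnion_le _).trans ?_
    -- Chebyshev gives `2 ^ (-(t + j + 2))`; the weaker terms `2 ^ (-(t + j + 1))` sum exactly to
    -- `2⁻ʲ`. The rounds share tosses, which a union bound permits.
    have hs : ∑' t : ℕ, (1 / 2 ^ j : ℝ) / 2 / 2 ^ t = 1 / 2 ^ j := tsum_geometric_two' _
    rw [← hs, ENNReal.ofReal_tsum_of_nonneg (fun t => by positivity) (summable_geometric_two' _)]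
    refine ENNReal.tsum_le_tsum fun t => (tossMeasure_deviation_le p _ (by positivity)).trans
      (ENNReal.ofReal_le_ofReal ?_)
    rw [sampleSize]
    push_cast
    rw [div_div, div_div, div_div, div_le_div_iff₀ (by positivity) (by positivity)]
    have : ((2 : ℝ) ^ (2 * t + j)) ^ 2 = 2 ^ (3 * t + j) * (2 ^ j * 2 ^ t) := by ring
    rw [this]
    nlinarith [show (0 : ℝ) < 2 ^ (3 * t + j) * (2 ^ j * 2 ^ t) by positivity]
  have h1 : (tossMeasure p).real Gᶜ ≤ 1 / 2 ^ j :=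
    ENNReal.toReal_le_of_le_ofReal (by positivity) hc
  rw [probReal_compl_eq_one_sub hG] at h1
  linarith

end

/-! ### Reading off binary digits from estimates -/

open Classical in
theorem exists_floor_codeProb {X : Set ℕ} (hX : ¬ IsDyadic (codeProb X : ℝ)) (i : ℕ) :
    ∃ a : ℕ, (a : ℝ) < 2 ^ (i + 1) * (codeProb X : ℝ) ∧
      2 ^ (i + 1) * (codeProb X : ℝ) < a + 1 ∧ (a % 2 = 1 ↔ i ∈ X) := by
  let d : ℕ → Fin 2 := fun n => if n ∈ X then 1 else 0
  have hp : (codeProb X : ℝ) = Real.ofDigits d := rfl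
  have hsum : ∀ n, ∃ a : ℕ, (a : ℝ) = 2 ^ (n + 1) *
      ∑ k ∈ Finset.range (n + 1), Real.ofDigitsTerm d k ∧ (a % 2 = 1 ↔ n ∈ X) := by
    have hd : ∀ n, (((d n : ℕ) = 1 ∧ n ∈ X) ∨ ((d n : ℕ) = 0 ∧ n ∉ X)) := fun n => by
      by_cases h : n ∈ X <;> simp [d, h]
    intro n
    induction n with
    | zero => exact ⟨d 0, by simp [Real.ofDigitsTerm]; ring, by rcases hd 0 with h | h <;> simp [h]⟩
    | succ n ih =>
      obtain ⟨a, ha, -⟩ := ih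
      refine ⟨2 * a + d (n + 1), ?_, by rcases hd (n + 1) with h | h <;> simp [h]⟩
      rw [Finset.sum_range_succ, mul_add]
      push_cast
      rw [ha, Real.ofDigitsTerm]
      push_cast
      field_simp
      ring
  obtain ⟨a, ha, hpar⟩ := hsum i
  have key : 2 ^ (i + 1) * Real.ofDigits d = a + Real.ofDigits fun k => d (k + (i + 1)) := by
    rw [Real.ofDigits_eq_sum_add_ofDigits d (i + 1), mul_add, ha]
    push_cast
    field_simp
  have h0 := Real.ofDigits_nonneg fun k => d (k + (i + 1))
  have h1 := Real.ofDigits_le_one fun k => d (k + (i + 1))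
  -- The tail of the expansion lies in `[0, 1]`; either endpoint would make `p` dyadic.
  have hne : ∀ b : ℤ, 2 ^ (i + 1) * Real.ofDigits d ≠ b := fun b hb =>
    hX ⟨b, i + 1, by rw [hp, ← hb]; field_simp⟩
  refine ⟨a, ?_, ?_, hpar⟩
  · rw [hp, key]
    refine lt_of_le_of_ne (by linarith) fun e => hne a ?_
    rw [key, ← e]; simp
  · rw [hp, key]
    refine lt_of_le_of_ne (by linarith) fun e => hne (a + 1) ?_
    rw [key, e]; simp

/-- The `i`-th binary digit of the numbers that differ from `S / 2 ^ (3 * t + j)` by at most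
`2⁻ᵗ`, if it is the same for all of them. -/
def digitEstimate (j t S i : ℕ) : Option Bool :=
  if 2 ^ (i + 1) * (S - 2 ^ (2 * t + j)) / sampleSize j t =
      2 ^ (i + 1) * (S + 2 ^ (2 * t + j)) / sampleSize j t then
    some (decide (2 ^ (i + 1) * (S - 2 ^ (2 * t + j)) / sampleSize j t % 2 = 1))
  else none

theorem sampleSize_pos (j t : ℕ) : 0 < sampleSize j t := by unfold sampleSize; positivity

section

variable {X : Set ℕ} (hX : ¬ IsDyadic (codeProb X : ℝ))
include hX

theorem digitEstimate_sound {j t S i : ℕ} {b : Bool}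
    (h : |(S : ℝ) - sampleSize j t * (codeProb X : ℝ)| < 2 ^ (2 * t + j))
    (hb : digitEstimate j t S i = some b) : b = true ↔ i ∈ X := by
  obtain ⟨a, h1, h2, ha⟩ := exists_floor_codeProb hX i
  set p : ℝ := (codeProb X : ℝ)
  have hp : 0 ≤ p := (codeProb X).2.1
  have hN : (0 : ℝ) < sampleSize j t := by exact_mod_cast sampleSize_pos j t
  unfold digitEstimate at hb
  split_ifs at hb with e
  rw [abs_lt] at h
  have hlo : 2 ^ (i + 1) * (S - 2 ^ (2 * t + j)) / sampleSize j t ≤ a := by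
    -- Truncating the lower endpoint at zero is harmless because `p` is nonnegative.
    have : ((S - 2 ^ (2 * t + j) : ℕ) : ℝ) ≤ sampleSize j t * p := by
      rcases le_total S (2 ^ (2 * t + j)) with hS | hS
      · rw [Nat.sub_eq_zero_of_le hS]; simp; positivity
      · rw [Nat.cast_sub hS]; push_cast; linarith
    rw [← Nat.lt_succ_iff, Nat.div_lt_iff_lt_mul (sampleSize_pos j t)]
    rify
    calc (2 : ℝ) ^ (i + 1) * ((S - 2 ^ (2 * t + j) : ℕ) : ℝ)
        ≤ 2 ^ (i + 1) * (sampleSize j t * p) := by gcongr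
      _ = (2 ^ (i + 1) * p) * sampleSize j t := by ring
      _ < (a + 1) * sampleSize j t := by gcongr
      _ = _ := by simp
  have hhi : a ≤ 2 ^ (i + 1) * (S + 2 ^ (2 * t + j)) / sampleSize j t := by
    rw [Nat.le_div_iff_mul_le (sampleSize_pos j t)]
    rify
    calc (a : ℝ) * sampleSize j t ≤ (2 ^ (i + 1) * p) * sampleSize j t := by gcongr
      _ = 2 ^ (i + 1) * (sampleSize j t * p) := by ring
      _ ≤ 2 ^ (i + 1) * (S + 2 ^ (2 * t + j)) := by gcongr; linarith
  rw [← Option.some.inj hb, decide_eq_true_iff, le_antisymm hlo (e ▸ hhi)]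
  exact ha

theorem digitEstimate_complete (i : ℕ) : ∃ t₀, ∀ j t S : ℕ, t₀ ≤ t →
    |(S : ℝ) - sampleSize j t * (codeProb X : ℝ)| < 2 ^ (2 * t + j) →
      digitEstimate j t S i ≠ none := by
  obtain ⟨a, h1, h2, ha⟩ := exists_floor_codeProb hX i
  set p : ℝ := (codeProb X : ℝ)
  -- Both endpoints are within `2 * 2⁻ᵗ` of `p`; scaling by `2 ^ (i + 1)` gives the factor `2 ^ (i +
  -- 2)`, and the distance to the nearest integers must exceed this.
  obtain ⟨t₀, ht₀⟩ := exists_pow_lt_of_lt_one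
    (show 0 < min (2 ^ (i + 1) * p - a) (a + 1 - 2 ^ (i + 1) * p) / 2 ^ (i + 2) by
      have := lt_min (sub_pos.2 h1) (sub_pos.2 h2); positivity) (show (1 / 2 : ℝ) < 1 by norm_num)
  refine ⟨t₀, fun j t S ht h => ?_⟩
  have hN : (0 : ℝ) < sampleSize j t := by exact_mod_cast sampleSize_pos j t
  have hd : (2 : ℝ) ^ (2 * t + j) = sampleSize j t * (1 / 2) ^ t := by
    rw [sampleSize]; push_cast
    rw [show 3 * t + j = 2 * t + j + t by ring, pow_add _ (2 * t + j) t, mul_assoc, ← mul_pow]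
    norm_num
  have hm : 2 ^ (i + 2) * (1 / 2 : ℝ) ^ t <
      min (2 ^ (i + 1) * p - a) (a + 1 - 2 ^ (i + 1) * p) := by
    have : (1 / 2 : ℝ) ^ t ≤ (1 / 2) ^ t₀ := pow_le_pow_of_le_one (by norm_num) (by norm_num) ht
    have := this.trans_lt ht₀
    rw [lt_div_iff₀ (by positivity)] at this
    linarith
  have hm1 := hm.trans_le (min_le_left _ _)
  have hm2 := hm.trans_le (min_le_right _ _)
  rw [abs_lt] at h
  have hlo : a ≤ 2 ^ (i + 1) * (S - 2 ^ (2 * t + j)) / sampleSize j t := by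
    have : (S : ℝ) - 2 ^ (2 * t + j) ≤ ((S - 2 ^ (2 * t + j) : ℕ) : ℝ) := by
      have := le_tsub_add (a := 2 ^ (2 * t + j)) (b := S)
      rify at this
      linarith
    rw [Nat.le_div_iff_mul_le (sampleSize_pos j t)]
    rify
    calc (a : ℝ) * sampleSize j t
        ≤ (2 ^ (i + 1) * p - 2 ^ (i + 2) * (1 / 2) ^ t) * sampleSize j t := by gcongr; linarith
      _ = 2 ^ (i + 1) * (sampleSize j t * p - 2 ^ (2 * t + j) - 2 ^ (2 * t + j)) := by
          rw [hd]; ring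
      _ ≤ 2 ^ (i + 1) * ((S - 2 ^ (2 * t + j) : ℕ) : ℝ) := by gcongr; linarith
  have hhi : 2 ^ (i + 1) * (S + 2 ^ (2 * t + j)) / sampleSize j t ≤ a := by
    rw [← Nat.lt_succ_iff, Nat.div_lt_iff_lt_mul (sampleSize_pos j t)]
    rify
    calc (2 : ℝ) ^ (i + 1) * (S + 2 ^ (2 * t + j))
        ≤ 2 ^ (i + 1) * (sampleSize j t * p + 2 ^ (2 * t + j) + 2 ^ (2 * t + j)) := by
          gcongr; linarith
      _ = (2 ^ (i + 1) * p + 2 ^ (i + 2) * (1 / 2) ^ t) * sampleSize j t := by rw [hd]; ring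
      _ < (a + 1) * sampleSize j t := mul_lt_mul_of_pos_right (by linarith) hN
      _ = _ := by simp
  have hle : 2 ^ (i + 1) * (S - 2 ^ (2 * t + j)) / sampleSize j t ≤
      2 ^ (i + 1) * (S + 2 ^ (2 * t + j)) / sampleSize j t := by
    gcongr
    exact (Nat.sub_le _ _).trans (Nat.le_add_right _ _)
  rw [digitEstimate, if_pos (le_antisymm hle (hhi.trans hlo))]
  simp

end

/-! ### Simulating o-machines with partial information about the oracle -/

namespace OMachine

open Turing StateTransition

/-- A configuration whose tape is given by two lists: the squares to the left of the scanned one,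
the nearest first, and the squares from the scanned one to the right. -/
abbrev ListCfg : Type := ℕ × List ℕ × List ℕ

namespace ListCfg

def tape (c : ListCfg) : Tape ℕ := Tape.mk' (ListBlank.mk c.2.1) (ListBlank.mk c.2.2)

def toCfg (c : ListCfg) : TM0.Cfg ℕ ℕ := ⟨c.1, c.tape⟩

theorem nth_tape (q : ℕ) (L R : List ℕ) (k : ℕ) :
    (tape (q, L, R)).nth (k - L.length : ℤ) = (L.reverse ++ R).getI k := by
  induction L generalizing R with
  | nil => simp [tape, Tape.mk'_nth_nat, ListBlank.nth_mk]
  | cons a L ih =>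
    have := ih (a :: R)
    rw [tape, ← CoinMachine.move_right_mk, Tape.move_right_nth, List.length_cons,
      show (k - (L.length + 1 : ℕ) + 1 : ℤ) = k - L.length by push_cast; ring]
    simpa [tape] using this

theorem nth_tape_of_neg (q : ℕ) (L R : List ℕ) {z : ℤ} (hz : z < 0) :
    (tape (q, L, R)).nth (z - L.length) = 0 := by
  induction L generalizing R with
  | nil =>
    cases z with
    | ofNat k => exact absurd hz (by simp)
    | negSucc k =>
      simp only [List.length_nil, Nat.cast_zero, sub_zero]
      change (ListBlank.mk ([] : List ℕ)).nth k = 0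
      rw [ListBlank.nth_mk]; rfl
  | cons a L ih =>
    have := ih (a :: R)
    rw [tape, ← CoinMachine.move_right_mk, Tape.move_right_nth, List.length_cons,
      show (z - (L.length + 1 : ℕ) + 1 : ℤ) = z - L.length by push_cast; ring]
    simpa [tape] using this

/-- The positions of the symbol `mu` in a list. -/
def muPositions (l : List ℕ) : List ℕ := (List.range l.length).filter fun i => l.getI i = mu

/-- The query posed by a tape inscription. -/
def query (c : ListCfg) : Option ℕ :=
  if (muPositions (c.2.1.reverse ++ c.2.2)).length = 2 then
    some ((muPositions (c.2.1.reverse ++ c.2.2)).getI 1 -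
      (muPositions (c.2.1.reverse ++ c.2.2)).getI 0 - 1)
  else none

theorem mem_muPositions {l : List ℕ} {k : ℕ} : k ∈ muPositions l ↔ l.getI k = mu := by
  rw [muPositions, List.mem_filter, List.mem_range, decide_eq_true_iff]
  refine ⟨fun h => h.2, fun h => ⟨?_, h⟩⟩
  by_contra! hk
  rw [List.getI_eq_default _ hk] at h
  exact absurd h (by decide)

theorem pairwise_muPositions (l : List ℕ) : (muPositions l).Pairwise (· < ·) :=
  List.pairwise_lt_range.filter _

theorem muPositions_eq_pair {l : List ℕ} {a n : ℕ}
    (h : ∀ k, l.getI k = mu ↔ k = a ∨ k = a + n + 1) : muPositions l = [a, a + n + 1] := by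
  refine List.Perm.eq_of_pairwise (le := (· < ·)) (fun a b _ _ h1 h2 => by omega)
    (pairwise_muPositions l) (by simp) ?_
  rw [List.perm_ext_iff_of_nodup ((pairwise_muPositions l).imp fun h => h.ne) (by simp; omega)]
  intro k
  simp [mem_muPositions, h]

/-- As `mu` is not the blank symbol, all its occurrences lie on the listed squares, so a finite
search decides which query is posed. -/
theorem queries_iff (c : ListCfg) (n : ℕ) : Queries c.tape n ↔ c.query = some n := by
  obtain ⟨q, L, R⟩ := c
  have key : Queries (tape (q, L, R)) n ↔
      ∃ a, ∀ k, (L.reverse ++ R).getI k = mu ↔ k = a ∨ k = a + n + 1 := by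
    constructor
    · rintro ⟨i, hi⟩
      have h0 : 0 ≤ i + L.length := by
        by_contra! h
        have h1 := (hi i).2 (.inl rfl)
        have h2 := nth_tape_of_neg q L R h
        rw [add_sub_cancel_right, h1] at h2
        exact absurd h2 (by decide)
      obtain ⟨a, ha⟩ := Int.eq_ofNat_of_zero_le h0
      refine ⟨a, fun k => ?_⟩
      rw [← nth_tape q, hi]
      omega
    · rintro ⟨a, ha⟩
      refine ⟨a - L.length, fun z => ?_⟩
      rcases lt_or_ge (z + L.length) 0 with hz | hz
      · have h2 := nth_tape_of_neg q L R hz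
        rw [add_sub_cancel_right] at h2
        rw [h2]
        exact ⟨fun h => absurd h (by decide), fun h => by omega⟩
      · obtain ⟨k, hk⟩ := Int.eq_ofNat_of_zero_le hz
        have h2 := nth_tape q L R k
        rw [← hk, add_sub_cancel_right] at h2
        rw [h2, ha]
        omega
  rw [key, query]
  constructor
  · rintro ⟨a, ha⟩
    rw [muPositions_eq_pair ha]
    simp [List.getI]
    omega
  · intro h
    split_ifs at h with hl
    obtain ⟨a, b, hab⟩ := List.length_eq_two.1 hl
    have hlt := pairwise_muPositions (L.reverse ++ R)
    simp only [hab, List.getI, List.pairwise_cons, List.mem_singleton, forall_eq] at h hlt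
    refine ⟨a, fun k => ?_⟩
    rw [← mem_muPositions, hab]
    have := Option.some.inj h
    simp at this hlt ⊢
    omega

open Classical in
theorem answer_tape (X : Set ℕ) (c : ListCfg) : answer X c.tape =
    c.query.map fun n => if n ∈ X then yesState else noState := by
  simp only [answer, queries_iff]
  cases h : c.query with
  | none => simp
  | some n => by_cases hn : n ∈ X <;> simp [hn]

/-- The effect of the action coded by `i`. -/
def act (i : ℕ) (T : List ℕ × List ℕ) : List ℕ × List ℕ :=
  if i = 0 then (T.1.tail, T.1.headI :: T.2)
  else if i = 1 then (T.2.headI :: T.1, T.2.tail)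
  else (T.1, (i - 2) :: T.2.tail)

/-- One step of the o-machine `M`, given the answers `o n` to some of the queries `n`: it is `none`
if the next step is unknown, and `some none` if the machine halts. -/
def next (M : OMachine) (o : ℕ → Option Bool) (c : ListCfg) : Option (Option ListCfg) :=
  if c.1 = queryState then
    (c.query.elim (some none) fun n => (o n).map fun b =>
      some (if b then yesState else noState, c.2))
  else some ((M.lookup (c.1, c.2.2.headI)).map fun e => (e.1, act e.2 c.2))

theorem toCfg_act (M : OMachine) (c : ListCfg) :
    TM0.step M.machine c.toCfg = ((M.lookup (c.1, c.2.2.headI)).map fun e =>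
      (e.1, act e.2 c.2)).map toCfg := by
  obtain ⟨q, L, R⟩ := c
  change Option.map _ (machine M q (ListBlank.mk R).head) = _
  rw [machine, ListBlank.head_mk, Option.map_map, Option.map_map]
  refine congrArg (Option.map · _) (funext fun e => ?_)
  obtain ⟨q', _ | _ | i⟩ := e
  · simp [action, act, toCfg, tape, Tape.move_left_mk']
  · simp [action, act, toCfg, tape, Tape.move_right_mk']
  · simp [action, act, toCfg, tape, Tape.write_mk']

theorem step_toCfg {M : OMachine} {X : Set ℕ} {o : ℕ → Option Bool} {c : ListCfg}
    (ho : ∀ n b, o n = some b → (b = true ↔ n ∈ X)) {x : Option ListCfg}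
    (h : c.next M o = some x) : M.step X c.toCfg = x.map toCfg := by
  classical
  unfold next at h
  split_ifs at h with hq
  · rw [step, if_pos (by exact hq)]
    change (answer X c.tape).map _ = _
    rw [answer_tape]
    cases hn : c.query with
    | none =>
      rw [hn] at h
      cases Option.some.inj h
      rfl
    | some n =>
      rw [hn, Option.elim_some, Option.map_eq_some_iff] at h
      obtain ⟨b, hb, rfl⟩ := h
      simp only [Option.map_some, ← ho n b hb]
      rfl
  · rw [step, if_neg (by exact hq), toCfg_act, Option.some.inj h]

/-- Proceed to the next configuration, or stay if there is none or it is unknown. -/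
def advance (M : OMachine) (o : ℕ → Option Bool) (c : ListCfg) : ListCfg :=
  ((c.next M o).getD none).getD c

/-- The number written at the scanned square, if the machine has halted. -/
def output (M : OMachine) (o : ℕ → Option Bool) (c : ListCfg) : Option ℕ :=
  if c.next M o = some none then some (c.2.2.takeWhile (· = stroke)).length else none

def start (m : ℕ) : ListCfg := (0, [], List.replicate m stroke)

theorem toCfg_start (m : ℕ) : (start m).toCfg = TM0.init (List.replicate m stroke) := rfl

theorem reaches_advance {M : OMachine} {X : Set ℕ} {o : ℕ → Option Bool}
    (ho : ∀ n b, o n = some b → (b = true ↔ n ∈ X)) (c : ListCfg) (t : ℕ) :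
    Reaches (M.step X) c.toCfg ((advance M o)^[t] c).toCfg := by
  induction t with
  | zero => exact Relation.ReflTransGen.refl
  | succ t ih =>
    rw [Function.iterate_succ_apply']
    set d := (advance M o)^[t] c
    rcases h : d.next M o with _ | _ | e
    · simpa [advance, h] using ih
    · simpa [advance, h] using ih
    · refine ih.tail ?_
      rw [step_toCfg ho h]
      simp [advance, h]

end ListCfg

open ListCfg

/-- The output of the o-machine `M` on the input `m`, if it halts within `t` steps and the answers
to all queries posed in these steps are known. -/
def simulate (M : OMachine) (o : ℕ → Option Bool) (m t : ℕ) : Option ℕ :=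
  output M o ((advance M o)^[t] (start m))

/-- An unanswered query freezes the simulation without output, so an output certifies a genuine
halting run. -/
theorem mem_result_of_simulate {M : OMachine} {X : Set ℕ} {o : ℕ → Option Bool}
    (ho : ∀ n b, o n = some b → (b = true ↔ n ∈ X)) {m t r : ℕ}
    (h : simulate M o m t = some r) : r ∈ M.result X m := by
  rw [simulate, output] at h
  split_ifs at h with hn
  refine (Part.mem_map_iff _).2 ⟨_, mem_eval.2 ⟨toCfg_start m ▸ reaches_advance ho (start m) t,
    step_toCfg ho hn⟩, ?_⟩
  rw [← Option.some.inj h]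
  exact unaryRead_mk' (by decide) _ _

theorem next_congr {M : OMachine} {o o' : ℕ → Option Bool} {c : ListCfg}
    (h : ∀ n, c.query = some n → o n = o' n) : c.next M o = c.next M o' := by
  unfold ListCfg.next
  cases hq : c.query with
  | none => rfl
  | some n => simp [h n hq]

/-- The use principle: a halting computation depends on finitely many values of the oracle. -/
theorem exists_simulate_of_dom {M : OMachine} {X : Set ℕ} {m : ℕ} (h : (M.result X m).Dom) :
    ∃ (T : ℕ) (Q : Finset ℕ), ∀ (o : ℕ → Option Bool) (t : ℕ), T ≤ t →
      (∀ n b, o n = some b → (b = true ↔ n ∈ X)) → (∀ n ∈ Q, o n ≠ none) →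
      simulate M o m t ≠ none := by
  classical
  let oX : ℕ → Option Bool := fun n => some (decide (n ∈ X))
  have hoX : ∀ n b, oX n = some b → (b = true ↔ n ∈ X) := fun n b hb => by
    rw [← Option.some.inj hb, decide_eq_true_iff]
  have hsome : ∀ c : ListCfg, c.next M oX ≠ none := fun c => by
    unfold ListCfg.next
    split_ifs
    · cases c.query <;> simp [oX]
    · simp
  have hreach : ∀ b, Reaches (M.step X) (start m).toCfg b →
      ∃ T, ((advance M oX)^[T] (start m)).toCfg = b := by
    intro b hb
    induction hb with
    | refl => exact ⟨0, rfl⟩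
    | tail _ hbc ih =>
      obtain ⟨T, rfl⟩ := ih
      refine ⟨T + 1, ?_⟩
      rw [Function.iterate_succ_apply']
      set d := (advance M oX)^[T] (start m)
      rcases hd : d.next M oX with _ | _ | e
      · exact absurd hd (hsome d)
      · rw [step_toCfg hoX hd] at hbc
        simp at hbc
      · rw [step_toCfg hoX hd] at hbc
        simpa [advance, hd] using hbc
  have hd : (eval (M.step X) (TM0.init (List.replicate m stroke))).Dom := h
  obtain ⟨hr, hb⟩ := mem_eval.1 (Part.get_mem hd)
  obtain ⟨T, hT⟩ := hreach _ hr
  rw [← hT] at hb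
  have hhalt : ((advance M oX)^[T] (start m)).next M oX = some none := by
    rcases hd : ((advance M oX)^[T] (start m)).next M oX with _ | _ | e
    · exact absurd hd (hsome _)
    · rfl
    · rw [step_toCfg hoX hd] at hb
      simp at hb
  -- `Q` collects the queries met along the run with the full oracle `oX`.
  refine ⟨T, (Finset.range (T + 1)).biUnion fun s =>
    ((advance M oX)^[s] (start m)).query.toFinset, fun o t ht ho hQ => ?_⟩
  have hnext : ∀ s ≤ T, ((advance M oX)^[s] (start m)).next M o =
      ((advance M oX)^[s] (start m)).next M oX := by
    intro s hs
    refine next_congr fun n hn => ?_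
    obtain ⟨b, hb⟩ := Option.ne_none_iff_exists'.1 (hQ n (by
      rw [Finset.mem_biUnion]
      exact ⟨s, Finset.mem_range.2 (by omega), by simp [hn]⟩))
    rw [hb]
    have := ho n b hb
    cases b <;> simp_all [oX]
  have hiter : ∀ s ≤ T, (advance M o)^[s] (start m) = (advance M oX)^[s] (start m) := by
    intro s
    induction s with
    | zero => exact fun _ => rfl
    | succ s ih =>
      intro hs
      rw [Function.iterate_succ_apply', Function.iterate_succ_apply', ih (by omega), advance,
        hnext s (by omega), advance]
  have hT' := (hnext T le_rfl).trans hhalt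
  -- A halted configuration is a fixed point of `advance`, so surplus steps change nothing.
  have hstay : (advance M o)^[t] (start m) = (advance M oX)^[T] (start m) := by
    obtain ⟨s, rfl⟩ := Nat.exists_eq_add_of_le' ht
    rw [Function.iterate_add_apply, hiter T le_rfl]
    refine Function.iterate_fixed ?_ s
    simp [advance, hT']
  rw [simulate, hstay, output, if_pos hT']
  simp

end OMachine

/-! ### The universal machine -/

namespace OMachine.ListCfg

theorem primrec_muPositions : Primrec muPositions := by
  have hR : PrimrecRel fun (i : ℕ) (l : List ℕ) => l.getI i = mu :=
    Primrec.eq.comp (Primrec.list_getI.comp Primrec.snd Primrec.fst) (.const mu)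
  exact hR.listFilter.comp (Primrec.list_range.comp Primrec.list_length) .id

theorem primrec_query : Primrec query := by
  have h : Primrec fun c : ListCfg => muPositions (c.2.1.reverse ++ c.2.2) :=
    primrec_muPositions.comp (Primrec.list_append.comp
      (Primrec.list_reverse.comp (Primrec.fst.comp Primrec.snd)) (Primrec.snd.comp Primrec.snd))
  exact Primrec.ite (Primrec.eq.comp (Primrec.list_length.comp h) (.const 2))
    (Primrec.option_some.comp (Primrec.nat_sub.comp (Primrec.nat_sub.comp
      (Primrec.list_getI.comp h (.const 1)) (Primrec.list_getI.comp h (.const 0))) (.const 1)))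
    (.const none)

theorem primrec_act : Primrec₂ act := by
  have i : Primrec fun x : ℕ × List ℕ × List ℕ => x.1 := Primrec.fst
  have l : Primrec fun x : ℕ × List ℕ × List ℕ => x.2.1 := Primrec.fst.comp Primrec.snd
  have r : Primrec fun x : ℕ × List ℕ × List ℕ => x.2.2 := Primrec.snd.comp Primrec.snd
  exact Primrec.ite (Primrec.eq.comp i (.const 0))
    ((Primrec.list_tail.comp l).pair (Primrec.list_cons.comp (Primrec.list_headI.comp l) r))
    (Primrec.ite (Primrec.eq.comp i (.const 1))
      ((Primrec.list_cons.comp (Primrec.list_headI.comp r) l).pair (Primrec.list_tail.comp r))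
      (l.pair (Primrec.list_cons.comp (Primrec.nat_sub.comp i (.const 2))
        (Primrec.list_tail.comp r))))

section

variable {α : Type*} [Primcodable α] {M : α → OMachine} {o : α → ℕ → Option Bool}
  (hM : Primrec M) (ho : Primrec₂ o)
include hM ho

theorem primrec_next : Primrec₂ fun a (c : ListCfg) => next (M a) (o a) c := by
  have hq : Primrec fun x : α × ListCfg => x.2.1 := Primrec.fst.comp Primrec.snd
  have ht : Primrec fun x : α × ListCfg => x.2.2 := Primrec.snd.comp Primrec.snd
  refine Primrec.ite (Primrec.eq.comp hq (.const queryState)) ?_ ?_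
  · refine (Primrec.option_casesOn (primrec_query.comp Primrec.snd) (.const (some none))
      (Primrec.option_map (ho.comp (Primrec.fst.comp Primrec.fst) Primrec.snd)
        (Primrec.option_some.comp (Primrec.pair (Primrec.ite
          (Primrec.eq.comp Primrec.snd (.const true)) (.const yesState) (.const noState))
          (ht.comp (Primrec.fst.comp Primrec.fst)))).to₂).to₂).of_eq fun x => ?_
    cases x.2.query <;> rfl
  · have hl : Primrec fun x : α × ListCfg => (M x.1).lookup (x.2.1, x.2.2.2.headI) := by
      -- `List.lookup` uses the product instance, `Primrec.listLookup` the one from decidable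
      -- equality.
      rw [lawful_beq_subsingleton (instBEqProd : BEq (ℕ × ℕ)) instBEqOfDecidableEq]
      exact Primrec.listLookup.comp (hq.pair (Primrec.list_headI.comp (Primrec.snd.comp ht)))
        (hM.comp Primrec.fst)
    exact Primrec.option_some.comp (Primrec.option_map hl
      ((Primrec.fst.comp Primrec.snd).pair (primrec_act.comp (Primrec.snd.comp Primrec.snd)
        (ht.comp Primrec.fst))).to₂)

theorem primrec_advance : Primrec₂ fun a (c : ListCfg) => advance (M a) (o a) c :=
  Primrec.option_getD.comp (Primrec.option_getD.comp (primrec_next hM ho) (.const none)) Primrec.snd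

theorem primrec_output : Primrec₂ fun a (c : ListCfg) => output (M a) (o a) c :=
  Primrec.ite (Primrec.eq.comp (primrec_next hM ho) (.const (some none)))
    (Primrec.option_some.comp (Primrec.list_length.comp ((Primrec.list_takeWhile
      (Primrec.eq.comp .id (.const stroke)).decide).comp
        (Primrec.snd.comp (Primrec.snd.comp Primrec.snd)))))
    (.const none)

theorem primrec_simulate {m t : α → ℕ} (hm : Primrec m) (ht : Primrec t) :
    Primrec fun a => simulate (M a) (o a) (m a) (t a) := by
  have hs : Primrec fun a => start (m a) := by
    refine (Primrec.const 0).pair ((Primrec.const []).pair ?_)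
    refine (Primrec.list_map (Primrec.list_range.comp hm) (Primrec.const stroke).to₂).of_eq ?_
    intro a
    simp
  exact (primrec_output hM ho).comp .id (Primrec.nat_iterate ht hs (primrec_advance hM ho))

end

end OMachine.ListCfg

/-! ### The universal test and its primitive recursiveness. -/

theorem primrec_ofIndex : Primrec OMachine.ofIndex :=
  (Primrec.option_getD.comp (Primrec.decode (α := OMachine)) (.const [])).of_eq fun n => by
    have h : (Encodable.decode n : Option OMachine) = some (OMachine.ofIndex n) :=
      Denumerable.decode_eq_ofNat OMachine n
    rw [h, Option.getD_some]

/-- The index of the estimate that uses `k` tosses, if there is one. -/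
def estimateIndex (j k : ℕ) : ℕ := (List.range (k + 1)).findIdx fun t => decide (sampleSize j t = k)

theorem primrec_sampleSize : Primrec₂ sampleSize :=
  Primrec.nat_pow.comp (.const 2) (Primrec.nat_add.comp
    (Primrec.nat_mul.comp (.const 3) Primrec.snd) Primrec.fst)

theorem primrec_estimateIndex : Primrec₂ estimateIndex :=
  Primrec.list_findIdx (Primrec.list_range.comp (Primrec.succ.comp Primrec.snd))
    (Primrec.eq.comp (primrec_sampleSize.comp (Primrec.fst.comp Primrec.fst) Primrec.snd)
      (Primrec.snd.comp Primrec.fst)).decide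

theorem sampleSize_strictMono (j : ℕ) : StrictMono (sampleSize j) := fun a b h =>
  Nat.pow_lt_pow_right one_lt_two (by omega)

/-- The search range suffices because `t ≤ sampleSize j t`, and the index found is `t` because
`sampleSize j` is injective. -/
theorem estimateIndex_sampleSize (j t : ℕ) : estimateIndex j (sampleSize j t) = t := by
  have h := (sampleSize_strictMono j).le_apply (x := t)
  refine (List.findIdx_eq (by simp; omega)).2 ⟨by simp, fun i hi => ?_⟩
  simpa using (sampleSize_strictMono j hi).ne

theorem primrec_headCount : Primrec headCount :=
  (Primrec.list_length.comp (Primrec.listFilter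
    (Primrec.eq.comp .id (.const true)))).of_eq fun l => by
      rw [headCount, List.count_eq_length_filter]
      congr

theorem primrec_digitEstimate :
    Primrec₂ fun (x : ℕ × ℕ × ℕ) i => digitEstimate x.1 x.2.1 x.2.2 i := by
  have j : Primrec fun x : (ℕ × ℕ × ℕ) × ℕ => x.1.1 := Primrec.fst.comp Primrec.fst
  have t : Primrec fun x : (ℕ × ℕ × ℕ) × ℕ => x.1.2.1 :=
    Primrec.fst.comp (Primrec.snd.comp Primrec.fst)
  have S : Primrec fun x : (ℕ × ℕ × ℕ) × ℕ => x.1.2.2 :=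
    Primrec.snd.comp (Primrec.snd.comp Primrec.fst)
  have N := primrec_sampleSize.comp j t
  have d : Primrec fun x : (ℕ × ℕ × ℕ) × ℕ => 2 ^ (2 * x.1.2.1 + x.1.1) :=
    Primrec.nat_pow.comp (.const 2) (Primrec.nat_add.comp (Primrec.nat_mul.comp (.const 2) t) j)
  have e : Primrec fun x : (ℕ × ℕ × ℕ) × ℕ => 2 ^ (x.2 + 1) :=
    Primrec.nat_pow.comp (.const 2) (Primrec.succ.comp Primrec.snd)
  have lo := Primrec.nat_div.comp (Primrec.nat_mul.comp e (Primrec.nat_sub.comp S d)) N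
  have hi := Primrec.nat_div.comp (Primrec.nat_mul.comp e (Primrec.nat_add.comp S d)) N
  exact Primrec.ite (Primrec.eq.comp lo hi) (Primrec.option_some.comp
    (Primrec.eq.comp (Primrec.nat_mod.comp lo (.const 2)) (.const 1)).decide) (.const none)

/-- The result of the `n`-th o-machine on the input `m`, if it can be found with the oracle that is
estimated from the tosses `s.2`, where `s.1 = (j, n, m)`. -/
def universalTest (s : (ℕ × ℕ × ℕ) × List Bool) : Option ℕ :=
  if sampleSize s.1.1 (estimateIndex s.1.1 s.2.length) = s.2.length then
    (OMachine.ofIndex s.1.2.1).simulate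
      (digitEstimate s.1.1 (estimateIndex s.1.1 s.2.length) (headCount s.2)) s.1.2.2
      (estimateIndex s.1.1 s.2.length)
  else none

theorem primrec_universalTest : Primrec universalTest := by
  have j : Primrec fun s : (ℕ × ℕ × ℕ) × List Bool => s.1.1 := Primrec.fst.comp Primrec.fst
  have k : Primrec fun s : (ℕ × ℕ × ℕ) × List Bool => s.2.length :=
    Primrec.list_length.comp Primrec.snd
  have t := primrec_estimateIndex.comp j k
  refine Primrec.ite (Primrec.eq.comp (primrec_sampleSize.comp j t) k)
    (OMachine.ListCfg.primrec_simulate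
      (primrec_ofIndex.comp (Primrec.fst.comp (Primrec.snd.comp Primrec.fst)))
      (primrec_digitEstimate.comp ((j.pair (t.pair
        (primrec_headCount.comp Primrec.snd))).comp Primrec.fst) Primrec.snd).to₂
      (Primrec.snd.comp (Primrec.snd.comp Primrec.fst)) t) (.const none)

theorem length_tosses (ω : ℕ → Bool) (k : ℕ) : (CoinMachine.tosses ω k).length = k := by
  induction k with
  | zero => rfl
  | succ k ih => simp [CoinMachine.tosses, ih]

/-! ### Correctness of the universal test on accurate tosses. -/

section

variable {X : Set ℕ} (hX : ¬ IsDyadic (codeProb X : ℝ)) {j : ℕ} {ω : ℕ → Bool}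
  (hω : ∀ t, |(headCount (CoinMachine.tosses ω (sampleSize j t)) : ℝ) -
    sampleSize j t * (codeProb X : ℝ)| < 2 ^ (2 * t + j))
include hX hω

theorem mem_result_of_universalTest {n m k r : ℕ}
    (h : universalTest ((j, n, m), CoinMachine.tosses ω k) = some r) :
    r ∈ (OMachine.ofIndex n).result X m := by
  simp only [universalTest, length_tosses] at h
  split_ifs at h with hk
  refine OMachine.mem_result_of_simulate (fun i b hb => ?_) h
  have := hω (estimateIndex j k)
  rw [hk] at this
  exact digitEstimate_sound hX (by rwa [hk]) hb

theorem exists_universalTest {n m : ℕ} (h : ((OMachine.ofIndex n).result X m).Dom) :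
    ∃ k, universalTest ((j, n, m), CoinMachine.tosses ω k) ≠ none := by
  obtain ⟨T, Q, hQ⟩ := OMachine.exists_simulate_of_dom h
  choose t₀ ht₀ using digitEstimate_complete hX
  -- Late enough for the number of steps and for every digit that is queried.
  let t := max T (Q.sup t₀)
  refine ⟨sampleSize j t, ?_⟩
  simp only [universalTest, length_tosses, estimateIndex_sampleSize, if_true]
  exact hQ _ t (le_max_left _ _) (fun i b hb => digitEstimate_sound hX (hω t) hb)
    fun i hi => ht₀ i j t _ ((Finset.le_sup hi).trans (le_max_right _ _)) (hω t)

end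

theorem mainTheorem1 :
    ∃ P : PTM, ∀ X : Set ℕ, ¬ IsDyadic (codeProb X : ℝ) → ∀ j n m : ℕ,
      1 - 1 / 2 ^ j ≤ (tossMeasure (codeProb X)).real
        {ω | P.result ω [j, n, m] = (OMachine.ofIndex n).result X m} := by
  classical
  obtain ⟨P, hP⟩ := PTM.exists_of_primrec primrec_universalTest
  -- The good event does not depend on `n` and `m`; on it, equality of partial values covers halting
  -- and divergence alike.
  refine ⟨P, fun X hX j n m => (le_tossMeasure_estimates (codeProb X) j).trans
    (measureReal_mono fun ω hω => ?_)⟩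
  obtain ⟨h1, h2⟩ := hP ω j n m
  by_cases hd : ∃ k, universalTest ((j, n, m), CoinMachine.tosses ω k) ≠ none
  -- The machine stops at the first accepting number of tosses, hence `Nat.find`.
  · obtain ⟨r, hr⟩ := Option.ne_none_iff_exists'.1 (Nat.find_spec hd)
    have hP := h1 r _ hr fun i hi => not_not.1 (Nat.find_min hd hi)
    have hM := mem_result_of_universalTest hX hω hr
    exact (Part.eq_some_iff.2 hP).trans (Part.eq_some_iff.2 hM).symm
  · have hM : ¬ ((OMachine.ofIndex n).result X m).Dom := fun h =>
      hd (exists_universalTest hX hω h)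
    push Not at hd
    exact (h2 hd).trans (Part.eq_none_iff'.2 hM).symm
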